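/- Let $k,m\ge 0$ be integers and let $\Omega\subseteq\mathbb R^{2k+m}$ be an open set with coordinates $(u^1,\dots,u^k,v^1,\dots,v^k,x^1,\dots,x^m)$. For $1\le I\le k$ let $x^{\mu_I}$ run through the coordinates $u^a,v^a$ with $a>I$ and $x^1,\dots,x^m$. Let $H^{I,(1)}$, $H^{I,(0)}$ and $W^{I,(0)}_{\mu_I}$ ($1\le I\le k$) be smooth functions on $\Omega$ depending only on $u^1,\dots,u^k$, on the $v^a$ with $a>I$, and on $x^1,\dots,x^m$; let $W^{I,(1)}$ ($1\le I\le k-1$) be smooth functions on $\Omega$ depending only on $u^1,\dots,u^k$, on the $v^a$ with $a>I+1$, and on $x^1,\dots,x^m$. Put $\ell^I=\mathrm du^I$, $m^i=\mathrm dx^i$ and $$n^I=\mathrm dv^I+\bigl[v^IH^{I,(1)}+H^{I,(0)}\bigr]\mathrm du^I+v^IW^{I,(1)}\,\mathrm du^{I+1}+\sum_{\mu_I}W^{I,(0)}_{\mu_I}\,\mathrm dx^{\mu_I},$$ where the term with $\mathrm du^{I+1}$ is absent for $I=k$. Then $$\mathrm ds^2=\sum_{I=1}^k 2\,\ell^I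 n^I+\sum_{i,j=1}^m\delta_{ij}\,m^i m^j$$ (where $2\ell n=\ell\otimes n+n\otimes\ell$) is a smooth pseudo-Riemannian metric of signature $(k,k+m)$ ($k$ negative and $k+m$ positive directions) on $\Omega$, and it is VSI: all its polynomial curvature invariants vanish identically on $\Omega$. Here a polynomial curvature invariant is a real polynomial without constant term in complete contractions, by means of the inverse metric, of tensor products $\nabla^{q_1}R\otimes\cdots\otimes\nabla^{q_n}R$ with $n\ge 1$ and $q_j\ge 0$, where $R$ is the Riemann tensor and $\nabla$ the Levi-Civita connection. -/

import Mathlib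

open scoped ContDiff

noncomputable section

namespace VSI

/-! Pseudo-Riemannian geometry in a coordinate domain of `ι → ℝ`, by components. -/

section Geometry

variable {ι : Type} [Fintype ι] [DecidableEq ι]

/-- The partial derivative `∂f/∂y^a` at `p`. -/
def partialDeriv (a : ι) (f : (ι → ℝ) → ℝ) (p : ι → ℝ) : ℝ :=
  fderiv ℝ f p (Pi.single a 1)

/-- The symmetric matrix field `g` is, on `Ω`, a smooth pseudo-Riemannian metric of signature
`(neg, pos)`: at every point there is a basis orthonormal for `g` with `neg` vectors of square `-1`
and `pos` vectors of square `1`. -/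
structure IsPseudoRiemannianOn (g : (ι → ℝ) → Matrix ι ι ℝ) (Ω : Set (ι → ℝ))
    (neg pos : ℕ) : Prop where
  smooth : ∀ a b, ContDiffOn ℝ ∞ (fun p => g p a b) Ω
  symm : ∀ p ∈ Ω, (g p).IsSymm
  signature : ∀ p ∈ Ω, ∃ e : Module.Basis (Fin neg ⊕ Fin pos) ℝ (ι → ℝ), ∀ r s,
    e r ⬝ᵥ (g p).mulVec (e s) =
      if r = s then Sum.elim (fun _ => (-1 : ℝ)) (fun _ => 1) r else 0

/-- Christoffel symbols `Γ^c_{ab}` of the Levi-Civita connection. -/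
def christoffel (g : (ι → ℝ) → Matrix ι ι ℝ) (c a b : ι) (p : ι → ℝ) : ℝ :=
  (1 / 2 : ℝ) * ∑ d, (g p)⁻¹ c d *
    (partialDeriv a (fun y => g y b d) p + partialDeriv b (fun y => g y a d) p
      - partialDeriv d (fun y => g y a b) p)

/-- `R^d_{cab} = ∂_a Γ^d_{bc} - ∂_b Γ^d_{ac} + Γ^d_{ae} Γ^e_{bc} - Γ^d_{be} Γ^e_{ac}`. -/
def riemannUp (g : (ι → ℝ) → Matrix ι ι ℝ) (d c a b : ι) (p : ι → ℝ) : ℝ :=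
  partialDeriv a (christoffel g d b c) p - partialDeriv b (christoffel g d a c) p
    + ∑ e, (christoffel g d a e p * christoffel g e b c p
      - christoffel g d b e p * christoffel g e a c p)

/-- Covariant tensor fields of rank `r`, given by their coordinate components. -/
abbrev TensorField (ι : Type) (r : ℕ) : Type := (Fin r → ι) → (ι → ℝ) → ℝ

/-- The Riemann tensor `R_{dcab} = g_{de} R^e_{cab}`. -/
def riemann (g : (ι → ℝ) → Matrix ι ι ℝ) : TensorField ι 4 :=
  fun s p => ∑ e, g p (s 0) e * riemannUp g e (s 1) (s 2) (s 3) p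

/-- The covariant derivative `T_{b_1 … b_r ; a}`; the new index `a` is the last one. -/
def covDeriv (g : (ι → ℝ) → Matrix ι ι ℝ) {r : ℕ} (T : TensorField ι r) :
    TensorField ι (r + 1) :=
  fun s p => partialDeriv (s (Fin.last r)) (T (Fin.init s)) p
    - ∑ j : Fin r, ∑ e, christoffel g e (s (Fin.last r)) (Fin.init s j) p *
        T (Function.update (Fin.init s) j e) p

/-- The `q`-th iterated covariant derivative `∇^q R` of the Riemann tensor. -/
def nablaRiemann (g : (ι → ℝ) → Matrix ι ι ℝ) : (q : ℕ) → TensorField ι (4 + q)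
  | 0 => riemann g
  | q + 1 => covDeriv g (nablaRiemann g q)

/-- The complete contraction of `∇^{q_1} R ⊗ ⋯ ⊗ ∇^{q_n} R` in which the index slots are paired
off by `e` (the `s`-th pair consists of `e (s, 0)` and `e (s, 1)`), and the two slots of each pair
are contracted with the inverse metric. -/
def completeContraction (g : (ι → ℝ) → Matrix ι ι ℝ) {n N : ℕ} (q : Fin n → ℕ)
    (e : Fin N × Fin 2 ≃ (Σ j : Fin n, Fin (4 + q j))) (p : ι → ℝ) : ℝ :=
  ∑ idx : (Σ j : Fin n, Fin (4 + q j)) → ι,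
    (∏ s : Fin N, (g p)⁻¹ (idx (e (s, 0))) (idx (e (s, 1)))) *
      ∏ j : Fin n, nablaRiemann g (q j) (fun t => idx ⟨j, t⟩) p

/-- The polynomial curvature invariants of `g`: the real polynomials without constant term in the
complete contractions of products of (at least one) covariant derivatives of the Riemann tensor. -/
def polynomialCurvatureInvariants (g : (ι → ℝ) → Matrix ι ι ℝ) :
    NonUnitalSubalgebra ℝ ((ι → ℝ) → ℝ) :=
  NonUnitalAlgebra.adjoin ℝ
    {f | ∃ (n N : ℕ) (q : Fin n → ℕ) (e : Fin N × Fin 2 ≃ (Σ j : Fin n, Fin (4 + q j))),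
      0 < n ∧ f = completeContraction g q e}

/-- All polynomial curvature invariants of `g` vanish on `Ω`. -/
def IsVSIOn (g : (ι → ℝ) → Matrix ι ι ℝ) (Ω : Set (ι → ℝ)) : Prop :=
  ∀ f ∈ polynomialCurvatureInvariants g, ∀ p ∈ Ω, f p = 0

end Geometry

/-! The class of metrics. -/

/-- Labels of the coordinates `u^1, …, u^k, v^1, …, v^k, x^1, …, x^m` (numbered from `0`). -/
abbrev Coord (k m : ℕ) : Type := Fin k ⊕ Fin k ⊕ Fin m

section Family

variable {k m : ℕ}

/-- The label of `u^I`. -/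
abbrev uC (I : Fin k) : Coord k m := Sum.inl I

/-- The label of `v^I`. -/
abbrev vC (I : Fin k) : Coord k m := Sum.inr (Sum.inl I)

/-- The label of `x^i`. -/
abbrev xC (i : Fin m) : Coord k m := Sum.inr (Sum.inr i)

/-- The coordinates `u^a` (all `a`), `v^b` (`b > J`) and `x^i` (all `i`). -/
def varsAbove (k m J : ℕ) : Set (Coord k m) :=
  {c | (∃ a, c = uC a) ∨ (∃ b : Fin k, J < (b : ℕ) ∧ c = vC b) ∨ ∃ i, c = xC i}

/-- The coordinates `x^{μ_I}`, that is, `u^a` (`a > I`), `v^a` (`a > I`) and `x^i` (all `i`). -/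
def transverse (I : Fin k) : Set (Coord k m) :=
  {c | (∃ a, I < a ∧ c = uC a) ∨ (∃ a, I < a ∧ c = vC a) ∨ ∃ i, c = xC i}

/-- `f` is smooth on `Ω` and is there a function of the coordinates in `S` alone. -/
def IsSmoothFunctionOf (Ω : Set (Coord k m → ℝ)) (S : Set (Coord k m))
    (f : (Coord k m → ℝ) → ℝ) : Prop :=
  ContDiffOn ℝ ∞ f Ω ∧ ∀ p ∈ Ω, ∀ q ∈ Ω, (∀ c ∈ S, p c = q c) → f p = f q

/-- The coordinate one-form `dy^c`, by its components. -/
def dCoord (c : Coord k m) : Coord k m → ℝ := Pi.single c 1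

/-- The one-form `ℓ^I = du^I`. -/
def ellForm (I : Fin k) : Coord k m → ℝ := dCoord (uC I)

/-- The one-form `m^i = dx^i`. -/
def mForm (i : Fin m) : Coord k m → ℝ := dCoord (xC i)

open Classical in
/-- The one-form `n^I = dv^I + (v^I H^{I,(1)} + H^{I,(0)}) du^I + v^I W^{I,(1)} du^{I+1}
+ W^{I,(0)}_{μ_I} dx^{μ_I}` at `p`; for `I = k` there is no `du^{I+1}` and that term is absent. -/
def nForm (H1 H0 W1 : Fin k → (Coord k m → ℝ) → ℝ)
    (W0 : Fin k → Coord k m → (Coord k m → ℝ) → ℝ) (I : Fin k) (p : Coord k m → ℝ) :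
    Coord k m → ℝ :=
  dCoord (vC I) + (p (vC I) * H1 I p + H0 I p) • dCoord (uC I)
    + (if h : (I : ℕ) + 1 < k then (p (vC I) * W1 I p) • dCoord (uC ⟨(I : ℕ) + 1, h⟩) else 0)
    + ∑ c : Coord k m, if c ∈ transverse I then W0 I c p • dCoord c else 0

/-- The metric `∑_I 2 ℓ^I n^I + ∑_i m^i m^i`, where `2 ℓ n = ℓ ⊗ n + n ⊗ ℓ`. -/
def metric (H1 H0 W1 : Fin k → (Coord k m → ℝ) → ℝ)
    (W0 : Fin k → Coord k m → (Coord k m → ℝ) → ℝ) (p : Coord k m → ℝ) :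
    Matrix (Coord k m) (Coord k m) ℝ :=
  Matrix.of fun a b =>
    (∑ I, (ellForm I a * nForm H1 H0 W1 W0 I p b + nForm H1 H0 W1 W0 I p a * ellForm I b))
      + ∑ i, mForm i a * mForm i b

end Family

end VSI

end

namespace VSI

open Filter Topology

/-! The proof is a weight count. Give `u^I` a positive weight `A_I`, `v^I` the weight `-A_I` and
`x^i` the weight `0`. The flat metric `η = ∑ 2 du^I dv^I + ∑ (dx^i)²` pairs only indices of opposite
weights. The rest of the metric should have positive weight: at a point `p`, a derivative of `g - η`
may be nonzero only if the weights of its component and derivative indices add up to at least `1`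
(`metric_sub_flatMetric_weight`). This bound passes to the Christoffel symbols, the curvature and
all `∇^q R` (`nablaRiemann_weight`), while the inverse metric lives on index pairs of total weight
at most `0` (`inv_weight`). A nonzero term in a complete contraction of `n ≥ 1` factors would have
index weights adding up to at least `n` and to at most `0`, which is absurd
(`completeContraction_eq_zero`).

The coefficients are arbitrary smooth functions of the higher `v^a`, and each derivative along `v^a`
costs `A_a`, so no single choice of weights serves all orders. One invariant involves only finitely
many derivatives, so an order `N` is fixed and `A_I = (N + 3) A_{I+1}` is chosen: `N` derivatives
along higher `v^a` cannot exhaust `A_I`.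

The signature comes from the coframe `(ℓ^I ∓ n^I)/√2`, `m^i`, which is a basis because the `n^I` are
triangular in the `dv^a` modulo the `du^a` and `dx^i`. -/

theorem partialDeriv_congr {ι : Type} [DecidableEq ι] {Ω : Set (ι → ℝ)} (hΩ : IsOpen Ω)
    {f g : (ι → ℝ) → ℝ} (h : Set.EqOn f g Ω) (c : ι) :
    Set.EqOn (partialDeriv c f) (partialDeriv c g) Ω := by
  intro y hy
  have : f =ᶠ[𝓝 y] g := by
    filter_upwards [hΩ.mem_nhds hy] with z hz using h hz
  simp only [partialDeriv, this.fderiv_eq]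

theorem differentiableAt_of_contDiffOn {ι : Type} [Fintype ι] {Ω : Set (ι → ℝ)}
    (hΩ : IsOpen Ω) {f : (ι → ℝ) → ℝ}
    (hf : ContDiffOn ℝ ∞ f Ω) {y : ι → ℝ} (hy : y ∈ Ω) : DifferentiableAt ℝ f y :=
  (hf.contDiffAt (hΩ.mem_nhds hy)).differentiableAt (by simp)

/-! ### Weights of functions at a point -/

section Weight

variable {ι : Type} [Fintype ι] [DecidableEq ι] {Ω : Set (ι → ℝ)} {w : ι → ℤ} {p : ι → ℝ}

/-- `f` is smooth on `Ω`, and an iterated partial derivative of `f` of order at most `N`, in the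
directions `c₁, …, c_r`, vanishes at `p` unless `s + w c₁ + ⋯ + w c_r` is nonnegative. -/
def HasWeight (Ω : Set (ι → ℝ)) (w : ι → ℤ) (p : ι → ℝ) : ℕ → ℤ → ((ι → ℝ) → ℝ) → Prop
  | 0, s, f => ContDiffOn ℝ ∞ f Ω ∧ (s < 0 → f p = 0)
  | N + 1, s, f => ContDiffOn ℝ ∞ f Ω ∧ (s < 0 → f p = 0) ∧
      ∀ c, HasWeight Ω w p N (s + w c) (partialDeriv c f)

theorem contDiffOn_partialDeriv (hΩ : IsOpen Ω) {f : (ι → ℝ) → ℝ} (hf : ContDiffOn ℝ ∞ f Ω)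
    (c : ι) : ContDiffOn ℝ ∞ (partialDeriv c f) Ω :=
  (hf.fderiv_of_isOpen hΩ (m := ∞) (by simp)).clm_apply contDiffOn_const

namespace HasWeight

variable {N : ℕ} {s t : ℤ} {f g : (ι → ℝ) → ℝ}

theorem contDiffOn (h : HasWeight Ω w p N s f) : ContDiffOn ℝ ∞ f Ω := by
  cases N with
  | zero => exact h.1
  | succ N => exact h.1

theorem eq_zero (h : HasWeight Ω w p N s f) (hs : s < 0) : f p = 0 := by
  cases N with
  | zero => exact h.2 hs
  | succ N => exact h.2.1 hs

theorem partialDeriv (h : HasWeight Ω w p (N + 1) s f) (c : ι) :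
    HasWeight Ω w p N (s + w c) (partialDeriv c f) := h.2.2 c

theorem mono (h : HasWeight Ω w p N s f) (hst : s ≤ t) : HasWeight Ω w p N t f := by
  induction N generalizing s t f with
  | zero => exact ⟨h.1, fun ht => h.2 (by omega)⟩
  | succ N ih => exact ⟨h.1, fun ht => h.2.1 (by omega), fun c => ih (h.2.2 c) (by omega)⟩

theorem of_succ (h : HasWeight Ω w p (N + 1) s f) : HasWeight Ω w p N s f := by
  induction N generalizing s f with
  | zero => exact ⟨h.1, h.2.1⟩
  | succ N ih => exact ⟨h.1, h.2.1, fun c => ih (h.2.2 c)⟩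

theorem of_le {M : ℕ} (h : HasWeight Ω w p N s f) (hM : M ≤ N) : HasWeight Ω w p M s f := by
  induction N, hM using Nat.le_induction with
  | base => exact h
  | succ N _ ih => exact ih h.of_succ

theorem congr (hΩ : IsOpen Ω) (hp : p ∈ Ω) (h : HasWeight Ω w p N s f) (hfg : Set.EqOn g f Ω) :
    HasWeight Ω w p N s g := by
  induction N generalizing s f g with
  | zero => exact ⟨h.1.congr hfg, fun hs => (hfg hp).trans (h.2 hs)⟩
  | succ N ih =>
    exact ⟨h.1.congr hfg, fun hs => (hfg hp).trans (h.2.1 hs),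
      fun c => ih (h.2.2 c) (partialDeriv_congr hΩ hfg c)⟩

theorem zero : HasWeight Ω w p N s (fun _ => 0) := by
  induction N generalizing s with
  | zero => exact ⟨contDiffOn_const, fun _ => rfl⟩
  | succ N ih =>
    refine ⟨contDiffOn_const, fun _ => rfl, fun c => ?_⟩
    have : VSI.partialDeriv c (fun _ : ι → ℝ => (0 : ℝ)) = fun _ => 0 := by
      funext y; simp [VSI.partialDeriv]
    rw [this]; exact ih

theorem const {r : ℝ} (hr : r ≠ 0 → 0 ≤ s) : HasWeight Ω w p N s (fun _ => r) := by
  have h0 : s < 0 → r = 0 := fun hs => by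
    by_contra h; have := hr h; omega
  cases N with
  | zero => exact ⟨contDiffOn_const, h0⟩
  | succ N =>
    refine ⟨contDiffOn_const, h0, fun c => ?_⟩
    have : VSI.partialDeriv c (fun _ : ι → ℝ => r) = fun _ => 0 := by
      funext y; simp [VSI.partialDeriv]
    rw [this]; exact zero

theorem add (hΩ : IsOpen Ω) (hp : p ∈ Ω) (hf : HasWeight Ω w p N s f)
    (hg : HasWeight Ω w p N s g) : HasWeight Ω w p N s (fun y => f y + g y) := by
  induction N generalizing s f g with
  | zero =>
    exact ⟨hf.1.add hg.1, fun hs => by simp only [hf.2 hs, hg.2 hs, add_zero]⟩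
  | succ N ih =>
    refine ⟨hf.1.add hg.1, fun hs => by simp only [hf.2.1 hs, hg.2.1 hs, add_zero], fun c => ?_⟩
    refine (ih (hf.2.2 c) (hg.2.2 c)).congr hΩ hp fun y hy => ?_
    simp only [VSI.partialDeriv]
    rw [fderiv_fun_add (differentiableAt_of_contDiffOn hΩ hf.1 hy)
      (differentiableAt_of_contDiffOn hΩ hg.1 hy)]
    rfl

/-- By Leibniz it is enough to look at values at `p`, where `s + t < 0` forces one of the factors to
have negative weight. -/
theorem mul (hΩ : IsOpen Ω) (hp : p ∈ Ω) (hf : HasWeight Ω w p N s f)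
    (hg : HasWeight Ω w p N t g) : HasWeight Ω w p N (s + t) (fun y => f y * g y) := by
  have h0 : s + t < 0 → f p * g p = 0 := fun hst => by
    rcases lt_or_ge s 0 with hs | hs
    · rw [hf.eq_zero hs, zero_mul]
    · rw [hg.eq_zero (by omega), mul_zero]
  induction N generalizing s t f g with
  | zero => exact ⟨hf.1.mul hg.1, h0⟩
  | succ N ih =>
    refine ⟨hf.1.mul hg.1, h0, fun c => ?_⟩
    have zero_of {s t : ℤ} {f g : (ι → ℝ) → ℝ} (hf : HasWeight Ω w p N s f)
        (hg : HasWeight Ω w p N t g) (hst : s + t < 0) : f p * g p = 0 := by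
      rcases lt_or_ge s 0 with hs | hs
      · rw [hf.eq_zero hs, zero_mul]
      · rw [hg.eq_zero (by omega), mul_zero]
    have h1 := (ih hf.of_succ (hg.2.2 c) (zero_of hf.of_succ (hg.2.2 c))).mono
      (t := s + t + w c) (by omega)
    have h2 := (ih (hf.2.2 c) hg.of_succ (zero_of (hf.2.2 c) hg.of_succ)).mono
      (t := s + t + w c) (by omega)
    refine (h1.add hΩ hp h2).congr hΩ hp fun y hy => ?_
    simp only [VSI.partialDeriv]
    rw [fderiv_fun_mul (differentiableAt_of_contDiffOn hΩ hf.1 hy)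
      (differentiableAt_of_contDiffOn hΩ hg.1 hy)]
    simp [mul_comm]

theorem neg (hΩ : IsOpen Ω) (hp : p ∈ Ω) (hf : HasWeight Ω w p N s f) :
    HasWeight Ω w p N s (fun y => -f y) := by
  have h := (const (r := -1) (s := 0) fun _ => le_rfl).mul hΩ hp hf
  simpa using h

theorem sub (hΩ : IsOpen Ω) (hp : p ∈ Ω) (hf : HasWeight Ω w p N s f)
    (hg : HasWeight Ω w p N s g) : HasWeight Ω w p N s (fun y => f y - g y) := by
  simpa only [sub_eq_add_neg] using hf.add hΩ hp (hg.neg hΩ hp)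

theorem sum (hΩ : IsOpen Ω) (hp : p ∈ Ω) {κ : Type} (S : Finset κ)
    {F : κ → (ι → ℝ) → ℝ} (hF : ∀ j ∈ S, HasWeight Ω w p N s (F j)) :
    HasWeight Ω w p N s (fun y => ∑ j ∈ S, F j y) := by
  classical
  induction S using Finset.induction_on with
  | empty => simpa using zero
  | insert a S ha ih =>
    simp only [Finset.sum_insert ha]
    exact (hF a (by simp)).add hΩ hp (ih fun j hj => hF j (by simp [hj]))

theorem coord (c : ι) (hs : 0 ≤ s) (hc : 0 ≤ s + w c) :
    HasWeight Ω w p N s (fun y => y c) := by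
  have hd : ContDiffOn ℝ ∞ (fun y : ι → ℝ => y c) Ω := (contDiff_apply ℝ ℝ c).contDiffOn
  cases N with
  | zero => exact ⟨hd, fun h => absurd hs (by omega)⟩
  | succ N =>
    refine ⟨hd, fun h => absurd hs (by omega), fun a => ?_⟩
    have : VSI.partialDeriv a (fun y : ι → ℝ => y c) = fun _ => (Pi.single a 1 : ι → ℝ) c := by
      funext y
      simp only [VSI.partialDeriv]
      exact congrArg (fun L : (ι → ℝ) →L[ℝ] ℝ => L (Pi.single a 1))
        (ContinuousLinearMap.proj (R := ℝ) (φ := fun _ : ι => ℝ) c).fderiv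
    rw [this]
    refine const fun h => ?_
    have : c = a := by
      by_contra hne; exact h (Pi.single_eq_of_ne hne 1)
    rwa [← this]

/-- A crude bound: `N` derivatives lower the weight by at most `N * B`. It starts the bootstrap in
`inv_weight`. -/
theorem of_large {B : ℤ} (hΩ : IsOpen Ω) (hw : ∀ c, -B ≤ w c) (hB : 0 ≤ B)
    (hf : ContDiffOn ℝ ∞ f Ω) (hs : N * B ≤ s) : HasWeight Ω w p N s f := by
  induction N generalizing s f with
  | zero => exact ⟨hf, fun h => absurd hs (by simpa using h)⟩
  | succ N ih =>
    push_cast at hs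
    have : 0 ≤ (N : ℤ) * B := by positivity
    refine ⟨hf, fun h => absurd hs (by nlinarith), fun c => ?_⟩
    exact ih (contDiffOn_partialDeriv hΩ hf c) (by have := hw c; linarith)

end HasWeight

end Weight

/-! ### Curvature of a metric that is a positive perturbation of a constant one -/

section Curvature

variable {ι : Type} [Fintype ι] [DecidableEq ι] {Ω : Set (ι → ℝ)} {w : ι → ℤ} {p : ι → ℝ}
  {g : (ι → ℝ) → Matrix ι ι ℝ} {N : ℕ}

theorem contDiffOn_det {M : (ι → ℝ) → Matrix ι ι ℝ}
    (hM : ∀ a b, ContDiffOn ℝ ∞ (fun y => M y a b) Ω) :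
    ContDiffOn ℝ ∞ (fun y => (M y).det) Ω := by
  simp only [Matrix.det_apply']
  exact ContDiffOn.sum fun σ _ => contDiffOn_const.mul (contDiffOn_prod fun i _ => hM _ _)

theorem contDiffOn_inv (hg : ∀ a b, ContDiffOn ℝ ∞ (fun y => g y a b) Ω)
    (hdet : ∀ y ∈ Ω, (g y).det ≠ 0) (a b : ι) :
    ContDiffOn ℝ ∞ (fun y => (g y)⁻¹ a b) Ω := by
  have h : ∀ y, (g y)⁻¹ a b = (g y).det⁻¹ * ((g y).updateRow b (Pi.single a 1)).det := fun y => by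
    rw [Matrix.inv_def, Ring.inverse_eq_inv', Matrix.smul_apply, Matrix.adjugate_apply, smul_eq_mul]
  simp only [h]
  refine ((contDiffOn_det hg).inv hdet).mul (contDiffOn_det fun c d => ?_)
  by_cases hc : c = b
  · subst hc; simpa using contDiffOn_const
  · simpa [Matrix.updateRow_ne hc] using hg c d

/-- On `Ω`, the metric `g` is nondegenerate, and it differs from a constant metric `η` of weight
zero by a perturbation of positive weight at `p`, to order `N`. -/
structure IsPositivePerturbation (Ω : Set (ι → ℝ)) (w : ι → ℤ) (p : ι → ℝ) (N : ℕ)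
    (g : (ι → ℝ) → Matrix ι ι ℝ) (η η' : Matrix ι ι ℝ) : Prop where
  isOpen : IsOpen Ω
  mem : p ∈ Ω
  det_ne_zero : ∀ y ∈ Ω, (g y).det ≠ 0
  inv_mul : η' * η = 1
  weight : ∀ a b, η a b ≠ 0 → w a + w b = 0
  weight' : ∀ a b, η' a b ≠ 0 → w a + w b = 0
  sub_weight : ∀ a b, HasWeight Ω w p N (w a + w b - 1) (fun y => g y a b - η a b)

namespace IsPositivePerturbation

variable {η η' : Matrix ι ι ℝ}

theorem metric_weight (h : IsPositivePerturbation Ω w p N g η η') (a b : ι) :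
    HasWeight Ω w p N (w a + w b) (fun y => g y a b) := by
  have h1 : HasWeight Ω w p N (w a + w b) (fun _ => η a b) :=
    HasWeight.const fun hne => (h.weight a b hne).ge
  simpa using ((h.sub_weight a b).mono (t := w a + w b) (by omega)).add h.isOpen h.mem h1

/-- The resolvent identity `g⁻¹ = η' - η' (g - η) g⁻¹`. A weight bound for `g⁻¹` inserted on the
right comes out improved by one. -/
theorem inv_eq (h : IsPositivePerturbation Ω w p N g η η') (a b : ι) :
    Set.EqOn (fun y => (g y)⁻¹ a b)
      (fun y => η' a b - ∑ c, ∑ d, η' a c * ((g y c d - η c d) * (g y)⁻¹ d b)) Ω := by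
  intro y hy
  have hu : IsUnit (g y).det := isUnit_iff_ne_zero.2 (h.det_ne_zero y hy)
  have e : (g y)⁻¹ = η' - η' * ((g y - η) * (g y)⁻¹) := by
    rw [sub_mul, mul_sub, Matrix.mul_nonsing_inv _ hu, ← mul_assoc, h.inv_mul]; simp
  have := congrFun (congrFun e a) b
  simpa [Matrix.mul_apply, Finset.mul_sum] using this

theorem inv_weight (h : IsPositivePerturbation Ω w p N g η η') (a b : ι) :
    HasWeight Ω w p N (-w a - w b) (fun y => (g y)⁻¹ a b) := by
  have hΩ := h.isOpen
  have hp := h.mem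
  -- A defect `j` in the weight is removed one unit at a time, since `g - η` gains `1` in `inv_eq`.
  have key : ∀ j : ℕ, (∀ a b, HasWeight Ω w p N (-w a - w b + j) (fun y => (g y)⁻¹ a b)) →
      ∀ a b, HasWeight Ω w p N (-w a - w b) (fun y => (g y)⁻¹ a b) := by
    intro j
    induction j with
    | zero => intro hj a b; simpa using hj a b
    | succ j ih =>
      intro hj
      refine ih fun a b => ?_
      refine HasWeight.congr hΩ hp (HasWeight.sub hΩ hp ?_ ?_) (h.inv_eq a b)
      · exact HasWeight.const fun hne => by have := h.weight' a b hne; omega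
      · refine HasWeight.sum hΩ hp _ fun c _ => HasWeight.sum hΩ hp _ fun d _ => ?_
        have h1 : HasWeight Ω w p N (-w a - w c) (fun _ => η' a c) :=
          HasWeight.const fun hne => by have := h.weight' a c hne; omega
        refine (h1.mul hΩ hp ((h.sub_weight c d).mul hΩ hp (hj d b))).mono ?_
        push_cast; omega
  set B : ℤ := ∑ c, |w c| with hB
  have hB0 : 0 ≤ B := Finset.sum_nonneg fun c _ => abs_nonneg _
  have hwB : ∀ c, |w c| ≤ B := fun c =>
    Finset.single_le_sum (f := fun c => |w c|) (fun c _ => abs_nonneg _) (Finset.mem_univ c)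
  -- `N * B` pays for the derivatives, `2 * B` compensates `-w a - w b`.
  refine key (N * B + 2 * B).toNat (fun a b => ?_) a b
  refine HasWeight.of_large hΩ (fun c => (abs_le.1 (hwB c)).1) hB0
    (contDiffOn_inv (fun a b => (h.metric_weight a b).contDiffOn) h.det_ne_zero a b) ?_
  rw [Int.toNat_of_nonneg (by positivity)]
  have := (abs_le.1 (hwB a)).2
  have := (abs_le.1 (hwB b)).2
  linarith

theorem of_succ (h : IsPositivePerturbation Ω w p (N + 1) g η η') :
    IsPositivePerturbation Ω w p N g η η' :=
  { h with sub_weight := fun a b => (h.sub_weight a b).of_succ }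

theorem of_le {M : ℕ} (h : IsPositivePerturbation Ω w p N g η η') (hM : M ≤ N) :
    IsPositivePerturbation Ω w p M g η η' :=
  { h with sub_weight := fun a b => (h.sub_weight a b).of_le hM }

theorem partialDeriv_metric_weight (h : IsPositivePerturbation Ω w p (N + 1) g η η') (a b c : ι) :
    HasWeight Ω w p N (w a + w b + w c - 1) (partialDeriv c fun y => g y a b) := by
  refine (((h.sub_weight a b).partialDeriv c).mono (by omega)).congr h.isOpen h.mem fun y _ => ?_
  simp only [partialDeriv, fderiv_sub_const]

/-- The constant `η` drops out of the derivatives, so the gain of `1` in `g - η` survives; an upper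
index counts with the opposite sign. -/
theorem christoffel_weight (h : IsPositivePerturbation Ω w p (N + 1) g η η') (c a b : ι) :
    HasWeight Ω w p N (w a + w b - w c - 1) (christoffel g c a b) := by
  have hΩ := h.isOpen
  have hp := h.mem
  have h2 : HasWeight Ω w p N 0 (fun _ => (1 / 2 : ℝ)) := HasWeight.const fun _ => le_rfl
  refine (h2.mul hΩ hp (HasWeight.sum (s := w a + w b - w c - 1) hΩ hp _ fun d _ => ?_)).mono
    (by omega)
  have h3 : HasWeight Ω w p N (w a + w b + w d - 1) (fun y =>
      partialDeriv a (fun y => g y b d) y + partialDeriv b (fun y => g y a d) y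
        - partialDeriv d (fun y => g y a b) y) :=
    HasWeight.sub hΩ hp (HasWeight.add hΩ hp
      ((h.partialDeriv_metric_weight b d a).mono (by omega))
      ((h.partialDeriv_metric_weight a d b).mono (by omega)))
      (h.partialDeriv_metric_weight a b d)
  exact ((h.of_succ.inv_weight c d).mul hΩ hp h3).mono (by omega)

theorem riemannUp_weight (h : IsPositivePerturbation Ω w p (N + 2) g η η') (d c a b : ι) :
    HasWeight Ω w p N (w c + w a + w b - w d - 1) (riemannUp g d c a b) := by
  have hΩ := h.isOpen
  have hp := h.mem
  have hΓ := h.of_succ.christoffel_weight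
  refine HasWeight.add hΩ hp (HasWeight.sub hΩ hp
    (((h.christoffel_weight d b c).partialDeriv a).mono (by omega))
    (((h.christoffel_weight d a c).partialDeriv b).mono (by omega)))
    (HasWeight.sum hΩ hp _ fun e _ => HasWeight.sub hΩ hp
      (((hΓ d a e).mul hΩ hp (hΓ e b c)).mono (by omega))
      (((hΓ d b e).mul hΩ hp (hΓ e a c)).mono (by omega)))

theorem riemann_weight (h : IsPositivePerturbation Ω w p (N + 2) g η η') (s : Fin 4 → ι) :
    HasWeight Ω w p N (∑ i, w (s i) - 1) (riemann g s) := by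
  have hΩ := h.isOpen
  have hp := h.mem
  refine HasWeight.sum hΩ hp _ fun e _ => ?_
  refine ((h.of_succ.of_succ.metric_weight (s 0) e).mul hΩ hp
    (h.riemannUp_weight e (s 1) (s 2) (s 3))).mono ?_
  rw [Fin.sum_univ_four]; omega

/-- In a correction term the weight of the dummy index `e` cancels between `Γ` and `T`, so the term
even gains `2`. -/
theorem covDeriv_weight (h : IsPositivePerturbation Ω w p (N + 1) g η η') {r : ℕ}
    {T : TensorField ι r} (hT : ∀ s, HasWeight Ω w p (N + 1) (∑ i, w (s i) - 1) (T s))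
    (s : Fin (r + 1) → ι) : HasWeight Ω w p N (∑ i, w (s i) - 1) (covDeriv g T s) := by
  have hΩ := h.isOpen
  have hp := h.mem
  have hs : ∑ i, w (s i) = ∑ i, w (Fin.init s i) + w (s (Fin.last r)) := by
    rw [Fin.sum_univ_castSucc]; rfl
  refine HasWeight.sub hΩ hp (((hT (Fin.init s)).partialDeriv _).mono (by omega))
    (HasWeight.sum hΩ hp _ fun j _ => HasWeight.sum hΩ hp _ fun e _ => ?_)
  refine ((h.christoffel_weight e (s (Fin.last r)) (Fin.init s j)).mul hΩ hp
    (hT (Function.update (Fin.init s) j e)).of_succ).mono ?_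
  have h1 : ∑ i, w (Function.update (Fin.init s) j e i)
      = w e + ∑ i ∈ Finset.univ \ {j}, w (Fin.init s i) := by
    rw [← Finset.sum_update_of_mem (Finset.mem_univ j) (fun i => w (Fin.init s i)) (w e)]
    exact Finset.sum_congr rfl fun i _ => by
      simp only [Function.update_apply]; split_ifs <;> rfl
  have h2 : ∑ i, w (Fin.init s i)
      = w (Fin.init s j) + ∑ i ∈ Finset.univ \ {j}, w (Fin.init s i) := by
    rw [← Finset.sum_update_of_mem (Finset.mem_univ j) (fun i => w (Fin.init s i)) _]
    simp
  omega

theorem nablaRiemann_weight (q : ℕ) (h : IsPositivePerturbation Ω w p (N + q + 2) g η η')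
    (s : Fin (4 + q) → ι) : HasWeight Ω w p N (∑ i, w (s i) - 1) (nablaRiemann g q s) := by
  induction q generalizing N with
  | zero => exact h.riemann_weight s
  | succ q ih =>
    exact (h.of_le (by omega)).covDeriv_weight (T := nablaRiemann g q)
      (fun s => ih (N := N + 1) (h.of_le (by omega)) s) s

theorem completeContraction_eq_zero {n M : ℕ} (q : Fin n → ℕ) (hn : 0 < n)
    (e : Fin M × Fin 2 ≃ (Σ j : Fin n, Fin (4 + q j)))
    (h : IsPositivePerturbation Ω w p (∑ j, q j + 2) g η η') :
    completeContraction g q e p = 0 := by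
  refine Finset.sum_eq_zero fun idx _ => ?_
  by_contra hne
  obtain ⟨h1, h2⟩ := mul_ne_zero_iff.1 hne
  rw [Finset.prod_ne_zero_iff] at h1 h2
  have h3 : ∀ s : Fin M, w (idx (e (s, 0))) + w (idx (e (s, 1))) ≤ 0 := fun s => by
    by_contra hs
    exact h1 s (Finset.mem_univ s) ((h.inv_weight _ _).eq_zero (by omega))
  have h4 : ∀ j : Fin n, 1 ≤ ∑ t : Fin (4 + q j), w (idx ⟨j, t⟩) := fun j => by
    by_contra hs
    have hq : q j ≤ ∑ j, q j := Finset.single_le_sum (fun _ _ => Nat.zero_le _) (Finset.mem_univ j)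
    exact h2 j (Finset.mem_univ j) (((h.of_le (M := 0 + q j + 2) (by omega)).nablaRiemann_weight
      (q j) fun t => idx ⟨j, t⟩).eq_zero (by omega))
  have h5 : ∑ x : Fin M × Fin 2, w (idx (e x)) ≤ 0 := by
    rw [Fintype.sum_prod_type]
    exact Finset.sum_nonpos fun s _ => by simpa [Fin.sum_univ_two] using h3 s
  have h6 : (n : ℤ) ≤ ∑ x : (Σ j : Fin n, Fin (4 + q j)), w (idx x) := by
    rw [Fintype.sum_sigma]
    simpa using Finset.sum_le_sum fun j (_ : j ∈ Finset.univ) => h4 j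
  rw [Equiv.sum_comp e fun x => w (idx x)] at h5
  omega

end IsPositivePerturbation

theorem isVSIOn_of_completeContraction_eq_zero
    (h : ∀ (n M : ℕ) (q : Fin n → ℕ) (e : Fin M × Fin 2 ≃ (Σ j : Fin n, Fin (4 + q j))), 0 < n →
      ∀ p ∈ Ω, completeContraction g q e p = 0) : IsVSIOn g Ω := by
  intro f hf p hp
  induction hf using NonUnitalAlgebra.adjoin_induction with
  | mem f hf => obtain ⟨n, M, q, e, hn, rfl⟩ := hf; exact h n M q e hn p hp
  | add f₁ f₂ _ _ h₁ h₂ => simp [h₁, h₂]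
  | zero => rfl
  | mul f₁ f₂ _ _ h₁ h₂ => simp [h₁]
  | smul r f _ h₁ => simp [h₁]

end Curvature

/-! ### The weights of the coordinates -/

section Family

variable {k m : ℕ}

/-- The size of the weight of `u^I` and `v^I`; it decreases so fast with `I` that `N` times
its value at `I + 1` is smaller than its value at `I`. -/
def coordWeightAbs (k N I : ℕ) : ℤ := ((N : ℤ) + 3) ^ (k - I)

theorem coordWeightAbs_pos (k N I : ℕ) : 1 ≤ coordWeightAbs k N I :=
  one_le_pow₀ (by omega)

theorem coordWeightAbs_antitone (k N : ℕ) {I J : ℕ} (h : I ≤ J) :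
    coordWeightAbs k N J ≤ coordWeightAbs k N I :=
  pow_le_pow_right₀ (by omega) (by omega)

theorem coordWeightAbs_eq (N : ℕ) {I : ℕ} (h : I < k) :
    coordWeightAbs k N I = (N + 3) * coordWeightAbs k N (I + 1) := by
  rw [coordWeightAbs, coordWeightAbs, ← pow_succ']
  congr 1; omega

/-- The weight of a coordinate: positive for `u^I`, its opposite for `v^I`, zero for `x^i`. -/
def coordWeight (k m N : ℕ) : Coord k m → ℤ
  | Sum.inl I => coordWeightAbs k N I
  | Sum.inr (Sum.inl I) => -coordWeightAbs k N I
  | Sum.inr (Sum.inr _) => 0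

theorem neg_le_coordWeight_of_mem_varsAbove (N J : ℕ) {c : Coord k m}
    (hc : c ∈ varsAbove k m J) : -coordWeightAbs k N (J + 1) ≤ coordWeight k m N c := by
  have h1 := coordWeightAbs_pos k N (J + 1)
  rcases hc with ⟨a, rfl⟩ | ⟨b, hb, rfl⟩ | ⟨i, rfl⟩
  · have := coordWeightAbs_pos k N a
    simp only [coordWeight]; omega
  · have := coordWeightAbs_antitone k N (show J + 1 ≤ b by omega)
    simp only [coordWeight]; omega
  · simp only [coordWeight]; omega

theorem transverse_subset_varsAbove (I : Fin k) :
    transverse (m := m) I ⊆ varsAbove k m I := by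
  rintro c (⟨a, _, rfl⟩ | ⟨a, ha, rfl⟩ | ⟨i, rfl⟩)
  · exact Or.inl ⟨a, rfl⟩
  · exact Or.inr (Or.inl ⟨a, ha, rfl⟩)
  · exact Or.inr (Or.inr ⟨i, rfl⟩)

/-! ### Functions of some of the coordinates -/

section Dependence

variable {Ω : Set (Coord k m → ℝ)} {S : Set (Coord k m)} {f : (Coord k m → ℝ) → ℝ}

theorem eventually_add_smul_mem (hΩ : IsOpen Ω) {p : Coord k m → ℝ} (hp : p ∈ Ω)
    (v : Coord k m → ℝ) : ∀ᶠ t : ℝ in 𝓝 0, p + t • v ∈ Ω := by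
  have hc : ContinuousAt (fun t : ℝ => p + t • v) 0 := by fun_prop
  exact hc.eventually (by simpa using hΩ.mem_nhds hp)

theorem partialDeriv_eq_deriv (hΩ : IsOpen Ω) (hf : ContDiffOn ℝ ∞ f Ω) {p : Coord k m → ℝ}
    (hp : p ∈ Ω) (c : Coord k m) :
    partialDeriv c f p = deriv (fun t : ℝ => f (p + t • Pi.single c 1)) 0 :=
  (differentiableAt_of_contDiffOn hΩ hf hp).lineDeriv_eq_fderiv.symm

theorem IsSmoothFunctionOf.partialDeriv (hΩ : IsOpen Ω) (hf : IsSmoothFunctionOf Ω S f)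
    (c : Coord k m) : IsSmoothFunctionOf Ω S (partialDeriv c f) := by
  refine ⟨contDiffOn_partialDeriv hΩ hf.1 c, fun p hp q hq hpq => ?_⟩
  rw [partialDeriv_eq_deriv hΩ hf.1 hp, partialDeriv_eq_deriv hΩ hf.1 hq]
  refine Filter.EventuallyEq.deriv_eq ?_
  filter_upwards [eventually_add_smul_mem hΩ hp (Pi.single c 1),
    eventually_add_smul_mem hΩ hq (Pi.single c 1)] with t h1 h2
  exact hf.2 _ h1 _ h2 fun a ha => by simp [hpq a ha]

theorem IsSmoothFunctionOf.partialDeriv_eq_zero (hΩ : IsOpen Ω) (hf : IsSmoothFunctionOf Ω S f)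
    {c : Coord k m} (hc : c ∉ S) {p : Coord k m → ℝ} (hp : p ∈ Ω) :
    VSI.partialDeriv c f p = 0 := by
  rw [partialDeriv_eq_deriv hΩ hf.1 hp]
  suffices h : (fun t : ℝ => f (p + t • Pi.single c 1)) =ᶠ[𝓝 0] fun _ => f p by
    rw [h.deriv_eq, deriv_const]
  filter_upwards [eventually_add_smul_mem hΩ hp (Pi.single c 1)] with t ht
  refine hf.2 _ ht _ hp fun a ha => ?_
  have : a ≠ c := fun h => hc (h ▸ ha)
  simp [this]

/-- Derivatives in directions outside `S` vanish on `Ω`; each of the others costs at most `B`. -/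
theorem IsSmoothFunctionOf.hasWeight (hΩ : IsOpen Ω) (hf : IsSmoothFunctionOf Ω S f)
    {p : Coord k m → ℝ} (hp : p ∈ Ω) {w : Coord k m → ℤ} {B : ℤ} (hB : 0 ≤ B)
    (hw : ∀ c ∈ S, -B ≤ w c) {N : ℕ} {s : ℤ} (hs : N * B ≤ s) : HasWeight Ω w p N s f := by
  have h0 : 0 ≤ (N : ℤ) * B := by positivity
  induction N generalizing s f with
  | zero => exact ⟨hf.1, fun h => absurd hs (by simpa using h)⟩
  | succ N ih =>
    refine ⟨hf.1, fun h => by omega, fun c => ?_⟩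
    push_cast at hs
    by_cases hc : c ∈ S
    · exact ih (hf.partialDeriv hΩ c) (by have := hw c hc; linarith) (by positivity)
    · exact HasWeight.zero.congr hΩ hp fun y hy => hf.partialDeriv_eq_zero hΩ hc hy

theorem HasWeight.mul_dCoord {w : Coord k m → ℤ} {p : Coord k m → ℝ} {N : ℕ} {s t : ℤ}
    (hΩ : IsOpen Ω) (hp : p ∈ Ω) (hf : HasWeight Ω w p N s f) {c : Coord k m}
    (hs : s ≤ t + w c) (b : Coord k m) :
    HasWeight Ω w p N (t + w b) (fun y => f y * dCoord c b) := by
  have h1 : HasWeight Ω w p N (w b - w c) (fun _ => dCoord c b) := HasWeight.const fun h => by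
    have : b = c := by
      by_contra hne; exact h (Pi.single_eq_of_ne hne 1)
    simp [this]
  exact (hf.mul hΩ hp h1).mono (by omega)

end Dependence

/-! ### The metric as a perturbation of a flat one -/

/-- The involution of the coordinates which exchanges `u^I` and `v^I`. -/
def swapUV : Coord k m → Coord k m
  | Sum.inl I => vC I
  | Sum.inr (Sum.inl I) => uC I
  | Sum.inr (Sum.inr i) => xC i

theorem swapUV_swapUV (c : Coord k m) : swapUV (swapUV c) = c := by
  rcases c with I | I | i <;> rfl

theorem coordWeight_swapUV (N : ℕ) (c : Coord k m) :
    coordWeight k m N (swapUV c) = -coordWeight k m N c := by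
  rcases c with I | I | i <;> simp [swapUV, coordWeight]

/-- The flat metric `∑_I 2 du^I dv^I + ∑_i dx^i dx^i`. -/
def flatMetric (k m : ℕ) : Matrix (Coord k m) (Coord k m) ℝ :=
  Matrix.of fun a b => if b = swapUV a then 1 else 0

theorem flatMetric_mul_self : flatMetric k m * flatMetric k m = 1 := by
  ext a b
  simp only [Matrix.mul_apply, flatMetric, Matrix.of_apply, Matrix.one_apply, ite_mul, one_mul,
    zero_mul, Finset.sum_ite_eq', Finset.mem_univ, if_true, swapUV_swapUV, eq_comm]

theorem coordWeight_add_of_flatMetric_ne_zero (N : ℕ) (a b : Coord k m)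
    (h : flatMetric k m a b ≠ 0) : coordWeight k m N a + coordWeight k m N b = 0 := by
  have hb : b = swapUV a := by
    by_contra hne; exact h (by simp [flatMetric, hne])
  rw [hb, coordWeight_swapUV]; omega

theorem flatMetric_eq (a b : Coord k m) :
    flatMetric k m a b = (∑ I, (ellForm I a * dCoord (vC I) b + dCoord (vC I) a * ellForm I b))
      + ∑ i, mForm i a * mForm i b := by
  rcases a with I | I | i <;> rcases b with J | J | j <;>
    simp [flatMetric, swapUV, ellForm, mForm, dCoord, Pi.single_apply, eq_comm]

variable {H1 H0 W1 : Fin k → (Coord k m → ℝ) → ℝ} {W0 : Fin k → Coord k m → (Coord k m → ℝ) → ℝ}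
  {Ω : Set (Coord k m → ℝ)}

theorem metric_sub_flatMetric (a b : Coord k m) (y : Coord k m → ℝ) :
    metric H1 H0 W1 W0 y a b - flatMetric k m a b =
      ∑ I, ((nForm H1 H0 W1 W0 I y b - dCoord (vC I) b) * dCoord (uC I) a
        + (nForm H1 H0 W1 W0 I y a - dCoord (vC I) a) * dCoord (uC I) b) := by
  rw [flatMetric_eq, metric, Matrix.of_apply, add_sub_add_right_eq_sub, ← Finset.sum_sub_distrib]
  exact Finset.sum_congr rfl fun I _ => by rw [ellForm]; ring

/-- In the metric this form is multiplied by `du^I`, of weight `A_I`; the bound says that the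
product has positive weight. -/
theorem nForm_sub_dCoord_weight (hΩ : IsOpen Ω)
    (hH1 : ∀ I : Fin k, IsSmoothFunctionOf Ω (varsAbove k m I) (H1 I))
    (hH0 : ∀ I : Fin k, IsSmoothFunctionOf Ω (varsAbove k m I) (H0 I))
    (hW1 : ∀ I : Fin k, (I : ℕ) + 1 < k →
      IsSmoothFunctionOf Ω (varsAbove k m ((I : ℕ) + 1)) (W1 I))
    (hW0 : ∀ I : Fin k, ∀ c ∈ transverse (k := k) (m := m) I,
      IsSmoothFunctionOf Ω (varsAbove k m I) (W0 I c))
    {p : Coord k m → ℝ} (hp : p ∈ Ω) (N : ℕ) (I : Fin k) (b : Coord k m) :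
    HasWeight Ω (coordWeight k m N) p N (coordWeightAbs k N I - 1 + coordWeight k m N b)
      (fun y => nForm H1 H0 W1 W0 I y b - dCoord (vC I) b) := by
  classical
  set w := coordWeight k m N with hw
  set A := coordWeightAbs k N with hA
  have hdep {J : ℕ} {f : (Coord k m → ℝ) → ℝ} (hf : IsSmoothFunctionOf Ω (varsAbove k m J) f) :
      HasWeight Ω w p N (N * A (J + 1)) f :=
    hf.hasWeight hΩ hp (by have := coordWeightAbs_pos k N (J + 1); omega)
      (fun c hc => neg_le_coordWeight_of_mem_varsAbove N J hc) le_rfl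
  have hAI : A I = N * A (I + 1) + 3 * A (I + 1) := by
    rw [hA, coordWeightAbs_eq N I.isLt]; ring
  have hA1 : 1 ≤ A (I + 1) := coordWeightAbs_pos k N (I + 1)
  have hNA : 0 ≤ (N : ℤ) * A (I + 1) := by positivity
  -- The first derivative of `v^I` along itself is `1`, at cost `A I`; hence this is the least
  -- possible weight when `N ≥ 1`.
  have hv : HasWeight Ω w p N (A I) (fun y => y (vC I)) :=
    HasWeight.coord _ (by omega) (by simp [hw, coordWeight, hA])
  have hu : w (uC I) = A I := rfl
  have heq : (fun y => nForm H1 H0 W1 W0 I y b - dCoord (vC I) b) = fun y =>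
      (y (vC I) * H1 I y + H0 I y) * dCoord (uC I) b
        + (if h : (I : ℕ) + 1 < k then
            (y (vC I) * W1 I y) * dCoord (uC ⟨(I : ℕ) + 1, h⟩) b else 0)
        + ∑ c : Coord k m, if c ∈ transverse I then W0 I c y * dCoord c b else 0 := by
    funext y
    simp only [nForm, Pi.add_apply, Pi.smul_apply, Finset.sum_apply, smul_eq_mul]
    rw [add_assoc, add_assoc, add_sub_cancel_left, ← add_assoc]
    congr 1
    · congr 1
      split_ifs <;> simp
    · refine Finset.sum_congr rfl fun c _ => ?_
      split_ifs <;> simp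
  rw [heq]
  refine HasWeight.add hΩ hp (HasWeight.add hΩ hp ?_ ?_) ?_
  -- The factor `v^I` uses up one `A I`; the form `du^I` supplies a second, which exceeds `N * A (I
  -- + 1)`.
  · refine HasWeight.mul_dCoord (s := A I + N * A (I + 1)) hΩ hp
      (HasWeight.add hΩ hp (hv.mul hΩ hp (hdep (hH1 I))) ((hdep (hH0 I)).mono (by omega)))
      (by omega) b
  -- Here only the weight `A (I + 1)` of `du^{I+1}` is left to pay for the derivatives of `W1 I`. It
  -- exceeds `N * A (I + 2)`, which is why `W1 I` must not depend on `v^{I+1}`.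
  · by_cases h : (I : ℕ) + 1 < k
    · simp only [h, dif_pos]
      have hA2 : A (I + 1) = N * A (I + 1 + 1) + 3 * A (I + 1 + 1) := by
        rw [hA, coordWeightAbs_eq N h]; ring
      have hA3 : 1 ≤ A (I + 1 + 1) := coordWeightAbs_pos k N _
      have hu1 : w (uC ⟨(I : ℕ) + 1, h⟩) = A (I + 1) := rfl
      exact HasWeight.mul_dCoord hΩ hp (hv.mul hΩ hp (hdep (hW1 I h))) (by omega) b
    · simp only [h, dif_neg, not_false_eq_true]
      exact HasWeight.zero
  · refine HasWeight.sum hΩ hp _ fun c _ => ?_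
    by_cases hc : c ∈ transverse I
    · simp only [hc, if_true]
      -- Without a factor `v^I`, the full `A I` pays both for the derivatives and for a possibly
      -- negative weight of `dx^μ`.
      have : -A (I + 1) ≤ w c :=
        neg_le_coordWeight_of_mem_varsAbove N _ (transverse_subset_varsAbove I hc)
      exact HasWeight.mul_dCoord hΩ hp (hdep (hW0 I c hc)) (by omega) b
    · simp only [hc, if_false]
      exact HasWeight.zero

theorem metric_sub_flatMetric_weight (hΩ : IsOpen Ω)
    (hH1 : ∀ I : Fin k, IsSmoothFunctionOf Ω (varsAbove k m I) (H1 I))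
    (hH0 : ∀ I : Fin k, IsSmoothFunctionOf Ω (varsAbove k m I) (H0 I))
    (hW1 : ∀ I : Fin k, (I : ℕ) + 1 < k →
      IsSmoothFunctionOf Ω (varsAbove k m ((I : ℕ) + 1)) (W1 I))
    (hW0 : ∀ I : Fin k, ∀ c ∈ transverse (k := k) (m := m) I,
      IsSmoothFunctionOf Ω (varsAbove k m I) (W0 I c))
    {p : Coord k m → ℝ} (hp : p ∈ Ω) (N : ℕ) (a b : Coord k m) :
    HasWeight Ω (coordWeight k m N) p N (coordWeight k m N a + coordWeight k m N b - 1)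
      (fun y => metric H1 H0 W1 W0 y a b - flatMetric k m a b) := by
  simp only [metric_sub_flatMetric]
  have h1 (I : Fin k) (a b : Coord k m) :=
    (nForm_sub_dCoord_weight hΩ hH1 hH0 hW1 hW0 hp N I b).mul_dCoord (c := uC I)
      (t := coordWeight k m N b - 1) hΩ hp (by simp only [coordWeight]; omega) a
  exact HasWeight.sum hΩ hp _ fun I _ => HasWeight.add hΩ hp
    ((h1 I a b).mono (by omega)) ((h1 I b a).mono (by omega))

/-! ### The signature -/

/-- The orthonormal coframe `(ℓ^I - n^I) / √2`, `(ℓ^I + n^I) / √2`, `m^i`. -/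
noncomputable def coframe (n : Fin k → Coord k m → ℝ) : Fin k ⊕ (Fin k ⊕ Fin m) → Coord k m → ℝ
  | Sum.inl I => (√2)⁻¹ • (ellForm I - n I)
  | Sum.inr (Sum.inl I) => (√2)⁻¹ • (ellForm I + n I)
  | Sum.inr (Sum.inr i) => mForm i

/-- The signs of the squares of the elements of an orthonormal frame. -/
def frameSign {α β : Type} : α ⊕ β → ℝ := Sum.elim (fun _ => -1) (fun _ => 1)

theorem metric_eq_sum_coframe (p : Coord k m → ℝ) (a b : Coord k m) :
    metric H1 H0 W1 W0 p a b = ∑ t, frameSign t *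
      (coframe (fun I => nForm H1 H0 W1 W0 I p) t a
        * coframe (fun I => nForm H1 H0 W1 W0 I p) t b) := by
  simp only [metric, Matrix.of_apply, Fintype.sum_sum_type, frameSign, coframe, Sum.elim_inl,
    Sum.elim_inr, ← add_assoc, ← Finset.sum_add_distrib, one_mul]
  congr 1
  refine Finset.sum_congr rfl fun I _ => ?_
  simp only [Pi.smul_apply, Pi.add_apply, Pi.sub_apply, smul_eq_mul]
  have h2 : (√2)⁻¹ * (√2)⁻¹ = (1 / 2 : ℝ) := by
    rw [← mul_inv, Real.mul_self_sqrt (by norm_num)]; norm_num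
  linear_combination (-2 * (ellForm I a * nForm H1 H0 W1 W0 I p b
    + nForm H1 H0 W1 W0 I p a * ellForm I b)) * h2

theorem dCoord_dotProduct (c : Coord k m) (v : Coord k m → ℝ) : dCoord c ⬝ᵥ v = v c := by
  simp [dCoord]

theorem eq_zero_of_coframe_eq_zero (p v : Coord k m → ℝ)
    (h : ∀ t, coframe (fun I => nForm H1 H0 W1 W0 I p) t ⬝ᵥ v = 0) : v = 0 := by
  classical
  have h2 : (√2)⁻¹ ≠ (0 : ℝ) := by positivity
  have hm : ∀ I : Fin k, v (uC I) - nForm H1 H0 W1 W0 I p ⬝ᵥ v = 0 := fun I => by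
    have := h (Sum.inl I)
    simp only [coframe, smul_dotProduct, sub_dotProduct, ellForm, dCoord_dotProduct] at this
    exact (smul_eq_zero.1 this).resolve_left h2
  have hq : ∀ I : Fin k, v (uC I) + nForm H1 H0 W1 W0 I p ⬝ᵥ v = 0 := fun I => by
    have := h (Sum.inr (Sum.inl I))
    simp only [coframe, smul_dotProduct, add_dotProduct, ellForm, dCoord_dotProduct] at this
    exact (smul_eq_zero.1 this).resolve_left h2
  have hx : ∀ i, v (xC i) = 0 := fun i => by
    simpa only [coframe, mForm, dCoord_dotProduct] using h (Sum.inr (Sum.inr i))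
  have hu : ∀ I, v (uC I) = 0 := fun I => by linarith [hm I, hq I]
  have hn : ∀ I, nForm H1 H0 W1 W0 I p ⬝ᵥ v = 0 := fun I => by linarith [hm I, hq I]
  -- Downward induction on `I`: once the `u` and `x` components vanish, `n^I` involves only `dv^I`
  -- and the `dv^a` with `a > I`.
  have hv : ∀ d : ℕ, ∀ I : Fin k, k - I ≤ d → v (vC I) = 0 := by
    intro d
    induction d with
    | zero => intro I hI; omega
    | succ d ih =>
      intro I hI
      have := hn I
      have h3 : (∑ c : Coord k m, if c ∈ transverse I then W0 I c p • dCoord c else 0) ⬝ᵥ v = 0 := by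
        rw [sum_dotProduct]
        refine Finset.sum_eq_zero fun c _ => ?_
        split_ifs with hc
        · have hvc : v c = 0 := by
            rcases hc with ⟨a, _, rfl⟩ | ⟨a, ha, rfl⟩ | ⟨i, rfl⟩
            · exact hu a
            · exact ih a (by have : (I : ℕ) < a := ha; omega)
            · exact hx i
          rw [smul_dotProduct, dCoord_dotProduct, hvc, smul_zero]
        · exact zero_dotProduct v
      rw [nForm, add_dotProduct, add_dotProduct, add_dotProduct, h3, smul_dotProduct,
        dCoord_dotProduct, dCoord_dotProduct, hu I] at this
      split_ifs at this <;>
        simpa [smul_dotProduct, dCoord_dotProduct, hu] using this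
  funext c
  rcases c with I | I | i
  · exact hu I
  · exact hv k I (by omega)
  · exact hx i

theorem dotProduct_metric_mulVec (p x y : Coord k m → ℝ) :
    x ⬝ᵥ (metric H1 H0 W1 W0 p).mulVec y = ∑ t, frameSign t *
      ((coframe (fun I => nForm H1 H0 W1 W0 I p) t ⬝ᵥ x)
        * (coframe (fun I => nForm H1 H0 W1 W0 I p) t ⬝ᵥ y)) := by
  simp only [dotProduct, Matrix.mulVec, metric_eq_sum_coframe, Finset.mul_sum, Finset.sum_mul]
  conv_lhs => enter [2, a]; rw [Finset.sum_comm]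
  rw [Finset.sum_comm]
  refine Finset.sum_congr rfl fun t _ => ?_
  rw [Finset.sum_comm]
  refine Finset.sum_congr rfl fun a _ => Finset.sum_congr rfl fun b _ => by ring

/-- The frame dual to `coframe` is orthonormal, because the metric is the signed sum of squares of
the coframe. -/
theorem exists_basis_metric (p : Coord k m → ℝ) :
    ∃ e : Module.Basis (Fin k ⊕ (Fin k ⊕ Fin m)) ℝ (Coord k m → ℝ), ∀ r s,
      e r ⬝ᵥ (metric H1 H0 W1 W0 p).mulVec (e s) = if r = s then frameSign r else 0 := by
  let L : (Coord k m → ℝ) →ₗ[ℝ] (Fin k ⊕ (Fin k ⊕ Fin m) → ℝ) :=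
    Matrix.mulVecLin (Matrix.of (coframe fun I => nForm H1 H0 W1 W0 I p))
  have hL : Function.Injective L := (injective_iff_map_eq_zero L).2 fun v hv =>
    eq_zero_of_coframe_eq_zero p v fun t => congrFun hv t
  let E := LinearEquiv.ofInjectiveOfFinrankEq L hL rfl
  refine ⟨Module.Basis.ofEquivFun E, fun r s => ?_⟩
  have hE : ∀ t r, coframe (fun I => nForm H1 H0 W1 W0 I p) t ⬝ᵥ Module.Basis.ofEquivFun E r
      = (Pi.single r 1 : _ → ℝ) t := fun t r => by
    have : E (Module.Basis.ofEquivFun E r) = Pi.single r 1 := by simp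
    exact congrFun this t
  simp only [dotProduct_metric_mulVec, hE, Pi.single_apply, mul_ite, mul_one, mul_zero,
    Finset.sum_ite_eq', Finset.mem_univ, if_true]
  by_cases h : r = s
  · simp [h]
  · simp [h, Ne.symm h]

theorem det_metric_ne_zero (p : Coord k m → ℝ) : (metric H1 H0 W1 W0 p).det ≠ 0 := by
  intro h
  obtain ⟨v, hv0, hv⟩ := Matrix.exists_mulVec_eq_zero_iff.2 h
  obtain ⟨e, he⟩ := exists_basis_metric (H1 := H1) (H0 := H0) (W1 := W1) (W0 := W0) p
  refine hv0 (e.ext_elem fun r => ?_)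
  have h1 : e r ⬝ᵥ (metric H1 H0 W1 W0 p).mulVec v = e.repr v r * frameSign r := by
    conv_lhs => rw [← e.sum_repr v]
    simp only [Matrix.mulVec_sum, dotProduct_sum, Matrix.mulVec_smul, dotProduct_smul, he,
      smul_eq_mul, mul_ite, mul_zero, Finset.sum_ite_eq, Finset.mem_univ, if_true]
  rw [hv, dotProduct_zero] at h1
  have h2 : frameSign r ≠ 0 := by
    rcases r with r | r <;> simp [frameSign]
  simpa [h2] using h1.symm

theorem metric_isSymm (p : Coord k m → ℝ) : (metric H1 H0 W1 W0 p).IsSymm := by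
  ext a b
  simp only [Matrix.transpose_apply, metric_eq_sum_coframe, mul_comm]

theorem metric_signature (p : Coord k m → ℝ) :
    ∃ e : Module.Basis (Fin k ⊕ Fin (k + m)) ℝ (Coord k m → ℝ), ∀ r s,
      e r ⬝ᵥ (metric H1 H0 W1 W0 p).mulVec (e s) =
        if r = s then Sum.elim (fun _ => (-1 : ℝ)) (fun _ => 1) r else 0 := by
  obtain ⟨e, he⟩ := exists_basis_metric (H1 := H1) (H0 := H0) (W1 := W1) (W0 := W0) p
  refine ⟨e.reindex (Equiv.sumCongr (Equiv.refl _) finSumFinEquiv), fun r s => ?_⟩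
  rw [Module.Basis.reindex_apply, Module.Basis.reindex_apply, he]
  simp only [EmbeddingLike.apply_eq_iff_eq]
  rcases r with r | r <;> rfl

end Family

end VSI

theorem mainTheorem1 (k m : ℕ) (Ω : Set (VSI.Coord k m → ℝ)) (hΩ : IsOpen Ω)
    (H1 H0 W1 : Fin k → (VSI.Coord k m → ℝ) → ℝ)
    (W0 : Fin k → VSI.Coord k m → (VSI.Coord k m → ℝ) → ℝ)
    (hH1 : ∀ I : Fin k, VSI.IsSmoothFunctionOf Ω (VSI.varsAbove k m I) (H1 I))
    (hH0 : ∀ I : Fin k, VSI.IsSmoothFunctionOf Ω (VSI.varsAbove k m I) (H0 I))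
    (hW1 : ∀ I : Fin k, (I : ℕ) + 1 < k →
      VSI.IsSmoothFunctionOf Ω (VSI.varsAbove k m ((I : ℕ) + 1)) (W1 I))
    (hW0 : ∀ I : Fin k, ∀ c ∈ VSI.transverse (k := k) (m := m) I,
      VSI.IsSmoothFunctionOf Ω (VSI.varsAbove k m I) (W0 I c)) :
    VSI.IsPseudoRiemannianOn (VSI.metric H1 H0 W1 W0) Ω k (k + m) ∧
      VSI.IsVSIOn (VSI.metric H1 H0 W1 W0) Ω := by
  have hpert : ∀ p ∈ Ω, ∀ N, VSI.IsPositivePerturbation Ω (VSI.coordWeight k m N) p N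
      (VSI.metric H1 H0 W1 W0) (VSI.flatMetric k m) (VSI.flatMetric k m) := fun p hp N =>
    { isOpen := hΩ
      mem := hp
      det_ne_zero := fun y _ => VSI.det_metric_ne_zero y
      inv_mul := VSI.flatMetric_mul_self
      weight := VSI.coordWeight_add_of_flatMetric_ne_zero N
      weight' := VSI.coordWeight_add_of_flatMetric_ne_zero N
      sub_weight := VSI.metric_sub_flatMetric_weight hΩ hH1 hH0 hW1 hW0 hp N }
  refine ⟨⟨fun a b => ?_, fun p _ => VSI.metric_isSymm p, fun p _ => VSI.metric_signature p⟩,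
    -- The weights are adapted to each contraction separately, with order `∑ j, q j + 2`: two
    -- derivatives for `R` and enough for every `∇^{q_j}`.
    VSI.isVSIOn_of_completeContraction_eq_zero fun n M q e hn p hp =>
      (hpert p hp _).completeContraction_eq_zero q hn e⟩
  exact fun p hp => ((hpert p hp 0).metric_weight a b).contDiffOn p hp
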